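/- Theorem 1.1 (Conjecture of Z.-W. Sun). Let $p$ be a prime with $p \equiv 3 \pmod 4$. Then $$\sum_{k=0}^{p-1}\frac{\binom{2k}{k}^2}{8^k} \equiv -\sum_{k=0}^{p-1}\frac{\binom{2k}{k}^2}{(-16)^k} \pmod{p^3}.$$ Here, for rational numbers $a,b$ and a positive integer $m$, $a\equiv b \pmod m$ means that $a-b = m r$ for some rational number $r$ whose reduced denominator is coprime to $m$. -/

import Mathlib

/-- Congruence of rational numbers modulo `m`, as in `a ≡ b (mod m)` for fractions: the difference
`a - b` is `m` times a rational number whose reduced denominator is coprime to `m`. -/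
def RatModEq (m : ℕ) (a b : ℚ) : Prop :=
  ∃ r : ℚ, r.den.Coprime m ∧ a - b = (m : ℚ) * r

/-! Write p = 2n + 1 = 4m + 3, so n = 2m + 1 is odd, and a_k = binom(2k,k)²/16^k. The claim is that
∑_{k<p} a_k x^k takes values at 2 and −1 adding to 0 mod p³. With b_k the coefficients of the
shifted Legendre polynomial of degree n, a_k = b_k + p² e_k, where e_k is p-integral for k < p. That
polynomial is odd under x ↦ 1 − x, which swaps 2 and −1, so its contribution cancels exactly. It
remains to show E(2) + E(−1) = 0 in `ZMod p`, where E = ∑ e_k x^k.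

Modulo p, the hypergeometric operator L of the Legendre family sends E to B/4 + c x^(p−1), with B
the reduced Legendre polynomial. As L commutes with x ↦ 1 − x, the sum G = E(x) + E(1 − x) satisfies
L G = c (x^(p−1) + (1 − x)^(p−1)). L is self-adjoint for the pairing ∑ f_k h_(p−1−k). Pairing G with
the h (`greenCoeff`) for which L h has coefficients (−1)^k gives G(−1) = c (h_0 + ∑ h_k).

The core is that this bracket vanishes (`greenCoeff_sum`). With u = `halfRatio` and v = `dualRatio`,
it reduces to S = 2W, where S = ∑_{i<n} (−1)^i v_i² and W = `weightedLegendreSum` at n. Both are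
compared with T = ∑_{k≤m} u_k v_(m−k): (2m+1) u_m W = T is an identity independent of the
characteristic (`odd_mul_weightedLegendreSum`), S = v_m T holds when 4m + 3 = 0
(`sum_neg_one_pow_dualRatio_sq`), and (2m+1) u_m v_m = 2. -/

open Finset

/-! ### Half-integer Pochhammer ratios and Legendre-type partial sums -/

section HalfPochhammer

variable {K : Type*} [Field K] {p : ℕ}

/-- The ratio `(1/2)_j / j!`, that is `binom (2j) j / 4 ^ j`, in the field `K`. -/
def halfRatio (K : Type*) [Field K] (j : ℕ) : K :=
  ∏ i ∈ range j, ((2 * i + 1 : K) / (2 * i + 2))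

/-- The ratio `i! / (1/2)_{i+1}` in the field `K`. -/
def dualRatio (K : Type*) [Field K] (i : ℕ) : K :=
  2 / ((2 * i + 1) * halfRatio K i)

/-- The positive integers below `p` are nonzero in `K`. -/
def CharAtLeast (K : Type*) [Field K] (p : ℕ) : Prop :=
  ∀ i : ℕ, 0 < i → i < p → (i : K) ≠ 0

@[simp] lemma halfRatio_zero : halfRatio K 0 = 1 := by simp [halfRatio]

@[simp] lemma dualRatio_zero : dualRatio K 0 = 2 := by simp [dualRatio]

lemma halfRatio_succ (j : ℕ) :
    halfRatio K (j + 1) = halfRatio K j * ((2 * j + 1) / (2 * j + 2)) := by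
  rw [halfRatio, prod_range_succ, halfRatio]

namespace CharAtLeast

lemma succ_ne (hK : CharAtLeast K p) {j : ℕ} (h : j + 1 < p) : (j + 1 : K) ≠ 0 := by
  exact_mod_cast hK (j + 1) (by omega) h

lemma odd_ne (hK : CharAtLeast K p) {j : ℕ} (h : 2 * j + 1 < p) : (2 * j + 1 : K) ≠ 0 := by
  exact_mod_cast hK (2 * j + 1) (by omega) h

lemma even_ne (hK : CharAtLeast K p) {j : ℕ} (h : 2 * j + 2 < p) : (2 * j + 2 : K) ≠ 0 := by
  exact_mod_cast hK (2 * j + 2) (by omega) h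

lemma halfRatio_ne (hK : CharAtLeast K p) {j : ℕ} (h : 2 * j < p) : halfRatio K j ≠ 0 := by
  refine prod_ne_zero_iff.2 fun i hi => ?_
  rw [mem_range] at hi
  exact div_ne_zero (hK.odd_ne (by omega)) (hK.even_ne (by omega))

lemma halfRatio_mul_dualRatio (hK : CharAtLeast K p) {i : ℕ} (h : 2 * i + 1 < p) :
    halfRatio K i * dualRatio K i = 2 / (2 * i + 1) := by
  have h1 := hK.odd_ne h
  have h2 := hK.halfRatio_ne (j := i) (by omega)
  rw [dualRatio]
  field_simp

lemma dualRatio_succ (hK : CharAtLeast K p) {i : ℕ} (h : 2 * i + 3 < p) :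
    dualRatio K (i + 1) = dualRatio K i * ((2 * i + 2) / (2 * i + 3)) := by
  have h1 := hK.odd_ne (j := i) (by omega)
  have h2 := hK.halfRatio_ne (j := i) (by omega)
  have h3 := hK.even_ne (j := i) (by omega)
  have h4 : (2 * i + 3 : K) ≠ 0 := by exact_mod_cast hK (2 * i + 3) (by omega) h
  have h5 : (2 * (i + 1) + 1 : K) ≠ 0 := by convert h4 using 1; ring
  rw [dualRatio, dualRatio, halfRatio_succ]
  push_cast
  field_simp
  ring

/-- The product of the power series with coefficients `halfRatio` and `dualRatio`. -/
lemma sum_halfRatio_mul_dualRatio_succ (hK : CharAtLeast K p) {m : ℕ} (h : 2 * m + 3 < p) :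
    ∑ k ∈ range (m + 2), halfRatio K k * dualRatio K (m + 1 - k) =
      ∑ k ∈ range (m + 1), halfRatio K k * dualRatio K (m - k) +
        2 * halfRatio K (m + 1) / (2 * m + 3) := by
  have hm : (2 * m + 3 : K) ≠ 0 := by exact_mod_cast hK (2 * m + 3) (by omega) h
  -- The termwise differences are Gosper-summable; the right side is their antidifference.
  have key : ∀ r ≤ m + 1, ∑ k ∈ range r,
      (halfRatio K k * dualRatio K (m + 1 - k) - halfRatio K k * dualRatio K (m - k)) =
      -(2 / (2 * m + 3)) * (r * halfRatio K r * dualRatio K (m + 1 - r)) := by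
    intro r
    induction r with
    | zero => simp
    | succ r ih =>
      intro hr
      rw [sum_range_succ, ih (by omega)]
      obtain ⟨k, rfl⟩ : ∃ k, m = r + k := ⟨m - r, by omega⟩
      rw [show r + k + 1 - r = k + 1 by omega, show r + k - r = k by omega,
        show r + k + 1 - (r + 1) = k by omega, hK.dualRatio_succ (i := k) (by omega),
        halfRatio_succ]
      have h2 : (2 : K) ≠ 0 := by exact_mod_cast hK 2 (by omega) (by omega)
      have h3 := hK.succ_ne (j := r) (by omega)
      have h4 : (2 * k + 3 : K) ≠ 0 := by exact_mod_cast hK (2 * k + 3) (by omega) (by omega)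
      push_cast at hm ⊢
      field_simp
      ring
  have := key (m + 1) le_rfl
  rw [sum_sub_distrib] at this
  rw [sum_range_succ, sub_eq_iff_eq_add.1 this]
  simp only [Nat.sub_self, dualRatio_zero]
  push_cast
  field_simp
  ring

/-- Coefficients of Legendre type, `(-1)^j (1/2)_j (1/2)_{n-j} / (j! (n-j)!)`. -/
def _root_.legendreCoeff (K : Type*) [Field K] (n j : ℕ) : K :=
  (-1) ^ j * halfRatio K j * halfRatio K (n - j)

/-- The polynomials Q_n(x) = ∑ c_{n,j} x^j satisfy (n+2) Q_{n+2} = (n+3/2)(1−x) Q_{n+1} + (n+1) x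
Q_n. Dividing by 1 − x turns coefficients of Q_n and Q_{n+2} into partial sums. -/
lemma sum_legendreCoeff_add_two (hK : CharAtLeast K p) {n : ℕ} (h : 2 * n + 4 < p) :
    ∀ i ≤ n + 1, (n + 2) * ∑ j ∈ range (i + 1), legendreCoeff K (n + 2) j =
      (n + 1) * ∑ j ∈ range i, legendreCoeff K n j +
        (n + 3 / 2) * legendreCoeff K (n + 1) i := by
  have h2 : (2 : K) ≠ 0 := by exact_mod_cast hK 2 (by omega) (by omega)
  intro i
  induction i with
  | zero =>
    intro _
    have h3 : (n + 1 + 1 : K) ≠ 0 := by exact_mod_cast hK.succ_ne (j := n + 1) (by omega)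
    simp only [legendreCoeff, zero_add, sum_range_one, sum_range_zero, pow_zero, halfRatio_zero,
      Nat.sub_zero, halfRatio_succ (n + 1)]
    push_cast
    field_simp
    ring
  | succ i ih =>
    intro hi
    rw [sum_range_succ, mul_add, ih (by omega), sum_range_succ _ i]
    obtain ⟨k, rfl⟩ : ∃ k, n = i + k := ⟨n - i, by omega⟩
    simp only [legendreCoeff]
    rw [show i + k + 2 - (i + 1) = k + 1 by omega, show i + k - i = k by omega,
      show i + k + 1 - (i + 1) = k by omega, show i + k + 1 - i = k + 1 by omega,
      halfRatio_succ, halfRatio_succ]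
    have h3 := hK.succ_ne (j := i) (by omega)
    have h4 := hK.succ_ne (j := k) (by omega)
    push_cast
    field_simp
    ring

lemma _root_.sum_range_neg_one_pow_reflect (f : ℕ → K) (n : ℕ) :
    ∑ i ∈ range (n + 1), (-1) ^ i * f (n - i) =
      (-1) ^ n * ∑ i ∈ range (n + 1), (-1) ^ i * f i := by
  rw [← sum_range_reflect, mul_sum]
  refine sum_congr rfl fun i hi => ?_
  rw [mem_range] at hi
  obtain ⟨k, rfl⟩ : ∃ k, n = i + k := ⟨n - i, by omega⟩
  rw [show i + k + 1 - 1 - i = k by omega, show i + k - k = i by omega]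
  have h1 : (-1 : K) ^ i * (-1) ^ i = 1 := by rw [← mul_pow]; simp
  rw [pow_add]
  linear_combination -(f i * (-1) ^ k) * h1

lemma sum_range_neg_one_pow_symm_eq_zero (hK : CharAtLeast K p) (hp : 2 < p) {f : ℕ → K} {n : ℕ}
    (hn : Odd n) (hf : ∀ i ≤ n, f (n - i) = f i) :
    ∑ i ∈ range (n + 1), (-1) ^ i * f i = 0 := by
  have h2 : (2 : K) ≠ 0 := by exact_mod_cast hK 2 (by omega) hp
  have h := sum_range_neg_one_pow_reflect f n
  rw [hn.neg_one_pow, sum_congr rfl fun i hi => by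
    rw [hf i (by simpa [Nat.lt_succ_iff] using hi)]] at h
  have : 2 * ∑ i ∈ range (n + 1), (-1) ^ i * f i = 0 := by linear_combination h
  exact (mul_eq_zero.1 this).resolve_left h2

lemma sum_legendreCoeff_eq_zero (hK : CharAtLeast K p) (hp : 2 < p) {n : ℕ} (hn : Odd n) :
    ∑ j ∈ range (n + 1), legendreCoeff K n j = 0 := by
  have := hK.sum_range_neg_one_pow_symm_eq_zero hp hn
    (f := fun j => halfRatio K j * halfRatio K (n - j)) fun i hi => by
      rw [show n - (n - i) = i by omega, mul_comm]
  simpa [legendreCoeff, mul_assoc] using this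

lemma _root_.sum_range_succ_sub_mul (M s : ℕ → K) (m : ℕ) :
    ∑ i ∈ range m, (M (i + 1) - M i) * ∑ j ∈ range (i + 1), s j =
      M m * ∑ j ∈ range (m + 1), s j - ∑ i ∈ range (m + 1), M i * s i := by
  induction m with
  | zero => simp
  | succ m ih =>
    rw [sum_range_succ, ih, sum_range_succ _ (m + 1), sum_range_succ _ (m + 1)]
    ring

end CharAtLeast
end HalfPochhammer

/-! ### Recurrence for the weighted Legendre sum -/

section HalfPochhammer

variable {K : Type*} [Field K] {p : ℕ}

/-- The partial sums of the Legendre coefficients, weighted by products of dual ratios. -/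
def weightedLegendreSum (K : Type*) [Field K] (n : ℕ) : K :=
  ∑ i ∈ range n, dualRatio K i * dualRatio K (n - 1 - i) *
    ∑ j ∈ range (i + 1), legendreCoeff K n j

namespace CharAtLeast

lemma sum_dualRatio_mul_legendreCoeff (hK : CharAtLeast K p) {n : ℕ} (hn : Even n)
    (h : 2 * n + 1 < p) :
    (n + 1) * ∑ i ∈ range (n + 1), dualRatio K i * dualRatio K (n - i) * legendreCoeff K n i =
      2 * ∑ i ∈ range (n + 1), (-1) ^ i * (2 / (2 * i + 1) : K) := by
  have hr := sum_range_neg_one_pow_reflect (fun i => (2 / (2 * i + 1) : K)) n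
  rw [hn.neg_one_pow, one_mul] at hr
  rw [two_mul]
  nth_rewrite 1 [← hr]
  rw [← sum_add_distrib, mul_sum]
  refine sum_congr rfl fun i hi => ?_
  rw [mem_range] at hi
  obtain ⟨k, rfl⟩ : ∃ k, n = i + k := ⟨n - i, by omega⟩
  have h1 := hK.halfRatio_mul_dualRatio (i := i) (by omega)
  have h2 := hK.halfRatio_mul_dualRatio (i := k) (by omega)
  have h3 := hK.odd_ne (j := i) (by omega)
  have h4 := hK.odd_ne (j := k) (by omega)
  rw [legendreCoeff, show i + k - i = k by omega]
  calc _ = ((i + k : ℕ) + 1 : K) * (-1) ^ i * ((halfRatio K i * dualRatio K i) *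
        (halfRatio K k * dualRatio K k)) := by ring
    _ = _ := by
      rw [h1, h2]
      rw [mul_comm (2 : K)] at h3 h4
      push_cast
      field_simp
      ring

/-- The antidifference of `dualRatio i * dualRatio (n - 1 - i)` in the degree `n`. -/
def _root_.dualRatioPrimitive (K : Type*) [Field K] (n i : ℕ) : K :=
  dualRatio K i * dualRatio K (n - i) *
    (((n - i : ℕ) + 1 / 2) / (n + 1) - (i + 1) / (n + 2))

lemma dualRatioPrimitive_succ_sub (hK : CharAtLeast K p) {n i : ℕ} (hi : i < n)
    (h : 2 * n + 4 < p) :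
    dualRatioPrimitive K n (i + 1) - dualRatioPrimitive K n i =
      dualRatio K (i + 1) * dualRatio K (n - i) - dualRatio K i * dualRatio K (n - 1 - i) := by
  obtain ⟨k, rfl⟩ : ∃ k, n = i + 1 + k := ⟨n - i - 1, by omega⟩
  have h2 : (2 : K) ≠ 0 := by exact_mod_cast hK 2 (by omega) (by omega)
  have h3 : (2 * i + 3 : K) ≠ 0 := by exact_mod_cast hK (2 * i + 3) (by omega) (by omega)
  have h4 : (2 * k + 3 : K) ≠ 0 := by exact_mod_cast hK (2 * k + 3) (by omega) (by omega)
  have h5 : (i + 1 + k + 1 : K) ≠ 0 := by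
    exact_mod_cast hK (i + 1 + k + 1) (by omega) (by omega)
  have h6 : (i + 1 + k + 2 : K) ≠ 0 := by
    exact_mod_cast hK (i + 1 + k + 2) (by omega) (by omega)
  rw [dualRatioPrimitive, dualRatioPrimitive, show i + 1 + k - (i + 1) = k by omega,
    show i + 1 + k - i = k + 1 by omega, show i + 1 + k - 1 - i = k by omega,
    hK.dualRatio_succ (i := i) (by omega), hK.dualRatio_succ (i := k) (by omega)]
  push_cast
  field_simp
  ring

/-- Each u_i v_i is rational in i, so partial fractions apply; the mixed term cancels under i ↦ n −
i because n is odd. -/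
lemma sum_dualRatioPrimitive_mul_legendreCoeff (hK : CharAtLeast K p) {n : ℕ} (hn : Odd n)
    (h : 2 * n + 4 < p) :
    ∑ i ∈ range (n + 1), dualRatioPrimitive K n i * legendreCoeff K n i =
      (1 / (n + 1) + 1 / (n + 2)) * ∑ i ∈ range (n + 1), (-1) ^ i * (2 / (2 * i + 1) : K) := by
  have h2 : (2 : K) ≠ 0 := by exact_mod_cast hK 2 (by omega) (by omega)
  have hr := sum_range_neg_one_pow_reflect (fun i => (2 / (2 * i + 1) : K)) n
  have hz := hK.sum_range_neg_one_pow_symm_eq_zero (by omega) hn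
    (f := fun i => (2 / (2 * i + 1) : K) * (2 / (2 * (n - i : ℕ) + 1) : K)) fun i hi => by
      rw [show n - (n - i) = i by omega, mul_comm]
  rw [hn.neg_one_pow] at hr
  calc _ = ∑ i ∈ range (n + 1), (1 / (n + 1) * ((-1) ^ i * (2 / (2 * i + 1) : K)) -
        1 / (n + 2) * ((-1) ^ i * (2 / (2 * (n - i : ℕ) + 1) : K)) - 1 / (2 * (n + 2)) *
        ((-1) ^ i * ((2 / (2 * i + 1) : K) * (2 / (2 * (n - i : ℕ) + 1) : K)))) := by
        refine sum_congr rfl fun i hi => ?_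
        rw [mem_range] at hi
        obtain ⟨k, rfl⟩ : ∃ k, n = i + k := ⟨n - i, by omega⟩
        have h1 := hK.halfRatio_mul_dualRatio (i := i) (by omega)
        have h2' := hK.halfRatio_mul_dualRatio (i := k) (by omega)
        have h3 := hK.odd_ne (j := i) (by omega)
        have h4 := hK.odd_ne (j := k) (by omega)
        have h5 : (i + k + 1 : K) ≠ 0 := by exact_mod_cast hK (i + k + 1) (by omega) (by omega)
        have h6 : (i + k + 2 : K) ≠ 0 := by exact_mod_cast hK (i + k + 2) (by omega) (by omega)
        rw [legendreCoeff, dualRatioPrimitive, show i + k - i = k by omega]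
        calc _ = (-1) ^ i * ((halfRatio K i * dualRatio K i) * (halfRatio K k * dualRatio K k)) *
              (((k : ℕ) + 1 / 2) / ((i + k : ℕ) + 1) - (i + 1) / ((i + k : ℕ) + 2)) := by ring
          _ = _ := by
            rw [h1, h2']
            push_cast
            field_simp
            ring
    _ = _ := by
      rw [sum_sub_distrib, sum_sub_distrib, ← mul_sum, ← mul_sum, ← mul_sum, hz, hr]
      ring

/-- The partial-sum recurrence leaves weights v_{i+1} v_{n−i} where W_n needs v_i v_{n−1−i}. Their
difference is a difference of `dualRatioPrimitive`, so Abel summation applies, and the alternating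
sums of 2/(2i+1) then cancel up to one last term. -/
lemma weightedLegendreSum_add_two (hK : CharAtLeast K p) {n : ℕ} (hn : Odd n)
    (h : 2 * n + 4 < p) :
    (n + 2) * weightedLegendreSum K (n + 2) =
      (n + 1) * weightedLegendreSum K n + 2 / (n + 2) := by
  have h2 : (2 : K) ≠ 0 := by exact_mod_cast hK 2 (by omega) (by omega)
  have h5 : (n + 1 : K) ≠ 0 := by exact_mod_cast hK (n + 1) (by omega) (by omega)
  have h6 : (n + 2 : K) ≠ 0 := by exact_mod_cast hK (n + 2) (by omega) (by omega)
  have h7 : (2 * n + 3 : K) ≠ 0 := by exact_mod_cast hK (2 * n + 3) (by omega) (by omega)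
  have e1 := hK.sum_dualRatio_mul_legendreCoeff (n := n + 1) hn.add_one (by omega)
  have e2 := hK.sum_dualRatioPrimitive_mul_legendreCoeff hn h
  have e3 := sum_range_succ_sub_mul (dualRatioPrimitive K n) (legendreCoeff K n) n
  rw [hK.sum_legendreCoeff_eq_zero (by omega) hn, mul_zero, zero_sub, e2] at e3
  rw [sum_congr rfl fun i hi => by
    rw [hK.dualRatioPrimitive_succ_sub (mem_range.1 hi) h, sub_mul], sum_sub_distrib] at e3
  have e4 : (n + 2) * weightedLegendreSum K (n + 2) =
      (n + 1) * ∑ i ∈ range (n + 2), dualRatio K i * dualRatio K (n + 1 - i) *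
        ∑ j ∈ range i, legendreCoeff K n j +
      (n + 3 / 2) * ∑ i ∈ range (n + 2), dualRatio K i * dualRatio K (n + 1 - i) *
        legendreCoeff K (n + 1) i := by
    rw [weightedLegendreSum, mul_sum, mul_sum, mul_sum, ← sum_add_distrib]
    refine sum_congr rfl fun i hi => ?_
    rw [mem_range] at hi
    rw [show n + 2 - 1 - i = n + 1 - i by omega]
    linear_combination dualRatio K i * dualRatio K (n + 1 - i) *
      hK.sum_legendreCoeff_add_two h i (by omega)
  rw [sum_range_succ', sum_range_zero, mul_zero, add_zero, sum_range_succ,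
    hK.sum_legendreCoeff_eq_zero (by omega) hn, mul_zero, add_zero,
    sum_congr rfl fun i hi => by rw [show n + 1 - (i + 1) = n - i by omega]] at e4
  rw [sum_range_succ (fun i => (-1 : K) ^ i * _), hn.add_one.neg_one_pow] at e1
  push_cast at e1
  rw [← weightedLegendreSum] at e3
  rw [e4, sub_eq_iff_eq_add.1 e3]
  have e5 : ∑ i ∈ range (n + 2), dualRatio K i * dualRatio K (n + 1 - i) *
        legendreCoeff K (n + 1) i = 2 / (n + 2) * (∑ i ∈ range (n + 1),
          (-1) ^ i * (2 / (2 * i + 1) : K) + 2 / (2 * n + 3)) := by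
    have h8 : (n + 1 + 1 : K) ≠ 0 := by convert h6 using 1; ring
    rw [show (2 * (n + 1) + 1 : K) = 2 * n + 3 by ring] at e1
    rw [div_mul_eq_mul_div, eq_div_iff h6]
    linear_combination e1
  rw [e5]
  rw [mul_comm (2 : K)] at h7
  field_simp
  ring

/-- Both sides equal 2 at m = 0 and gain 2 u_{m+1}/(2m+3) at each step. -/
lemma odd_mul_weightedLegendreSum (hK : CharAtLeast K p) {m : ℕ} (h : 4 * m + 2 < p) :
    (2 * m + 1) * halfRatio K m * weightedLegendreSum K (2 * m + 1) =
      ∑ k ∈ range (m + 1), halfRatio K k * dualRatio K (m - k) := by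
  have h2 : (2 : K) ≠ 0 := by exact_mod_cast hK 2 (by omega) (by omega)
  induction m with
  | zero =>
    simp [weightedLegendreSum, legendreCoeff, halfRatio_succ]
  | succ m ih =>
    have h3 : (2 * m + 3 : K) ≠ 0 := by exact_mod_cast hK (2 * m + 3) (by omega) (by omega)
    have h4 := hK.succ_ne (j := m) (by omega)
    have := hK.weightedLegendreSum_add_two (n := 2 * m + 1) ⟨m, rfl⟩ (by omega)
    rw [hK.sum_halfRatio_mul_dualRatio_succ (by omega), ← ih (by omega),
      show 2 * (m + 1) + 1 = 2 * m + 1 + 2 by ring]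
    push_cast at this ⊢
    rw [show (2 * m + 1 + 2 : K) = 2 * m + 3 by ring] at this
    rw [show (2 * (m + 1) + 1 : K) = 2 * m + 3 by ring, mul_right_comm, this, halfRatio_succ]
    field_simp
    ring

end CharAtLeast
end HalfPochhammer

/-! ### Quarter-integer Pochhammer ratios and the alternating sum of squares -/

section Quarter

variable {K : Type*} [Field K] {p : ℕ}

/-- The rising product `x (x + 1) ⋯ (x + k - 1)`. -/
def risingProd (x : K) (k : ℕ) : K := ∏ i ∈ range k, (x + i)

@[simp] lemma risingProd_zero (x : K) : risingProd x 0 = 1 := by simp [risingProd]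

lemma risingProd_succ (x : K) (k : ℕ) : risingProd x (k + 1) = risingProd x k * (x + k) := by
  rw [risingProd, prod_range_succ, risingProd]

lemma risingProd_succ_left (x : K) (k : ℕ) :
    risingProd x (k + 1) = x * risingProd (x + 1) k := by
  rw [risingProd, prod_range_succ', risingProd, mul_comm, Nat.cast_zero, add_zero]
  congr 1
  exact prod_congr rfl fun i _ => by push_cast; ring

lemma risingProd_reflect (x : K) (k : ℕ) :
    risingProd (1 - x - k) k = (-1) ^ k * risingProd x k := by
  induction k generalizing x with
  | zero => simp
  | succ k ih =>
    rw [risingProd_succ, risingProd_succ_left x,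
      show 1 - x - (k + 1 : ℕ) = 1 - (x + 1) - k by push_cast; ring, ih]
    ring

/-- The ratio `(1/4)_r / (3/4)_r`. -/
def quarterRatio (K : Type*) [Field K] (r : ℕ) : K :=
  risingProd (1 / 4) r / risingProd (3 / 4) r

/-- The truncated sum of `(-m - 1/4)_k (1/4)_k / (k! (3/4)_k)`. -/
def quarterSum (K : Type*) [Field K] (m : ℕ) : K :=
  ∑ k ∈ range (m + 1), risingProd (-m - 1 / 4 : K) k * (quarterRatio K k / k.factorial)

namespace CharAtLeast

lemma four_ne (hK : CharAtLeast K p) (hp : 2 < p) : (4 : K) ≠ 0 := by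
  have h2 : (2 : K) ≠ 0 := by exact_mod_cast hK 2 (by omega) hp
  rw [show (4 : K) = 2 * 2 by norm_num]
  exact mul_ne_zero h2 h2

lemma three_quarters_add_ne (hK : CharAtLeast K p) {i : ℕ} (h : 4 * i + 3 < p) :
    (3 / 4 + i : K) ≠ 0 := by
  have h3 : (4 * i + 3 : K) ≠ 0 := by exact_mod_cast hK (4 * i + 3) (by omega) h
  have h4 := hK.four_ne (by omega)
  intro h0
  apply h3
  field_simp at h0
  linear_combination h0

lemma risingProd_three_quarters_ne (hK : CharAtLeast K p) {k : ℕ} (h : 4 * k ≤ p) :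
    risingProd (3 / 4 : K) k ≠ 0 :=
  prod_ne_zero_iff.2 fun i hi => hK.three_quarters_add_ne (by rw [mem_range] at hi; omega)

lemma factorial_ne (hK : CharAtLeast K p) {k : ℕ} (h : k < p) : (k.factorial : K) ≠ 0 := by
  induction k with
  | zero => simp
  | succ k ih =>
    rw [Nat.factorial_succ, Nat.cast_mul]
    exact mul_ne_zero (hK _ (by omega) h) (ih (by omega))

lemma quarterRatio_succ (r : ℕ) :
    quarterRatio K (r + 1) = quarterRatio K r * ((1 / 4 + r) / (3 / 4 + r)) := by
  rw [quarterRatio, risingProd_succ, risingProd_succ, quarterRatio, mul_div_mul_comm]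

/-- Zeilberger-style telescoping over k ≤ m. The boundary term and the extra summand k = m + 1 carry
factors m + 3/4 and −(m + 5/4), which combine into the last term. -/
lemma quarterSum_succ (hK : CharAtLeast K p) {m : ℕ} (h : 4 * m + 3 < p) :
    (m + 1) * quarterSum K (m + 1) = (m + 3 / 4) * quarterSum K m +
      2 * (-1) ^ (m + 1) * ((m + 1) * risingProd (1 / 4) (m + 1) *
        (quarterRatio K (m + 1) / (m + 1).factorial)) := by
  have hf := hK.four_ne (by omega)
  have key : ∀ r ≤ m, ∑ k ∈ range (r + 1), ((m + 1) *
      (risingProd (-(m + 1 : ℕ) - 1 / 4 : K) k * (quarterRatio K k / k.factorial)) -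
      (m + 3 / 4) * (risingProd (-m - 1 / 4 : K) k * (quarterRatio K k / k.factorial))) =
      risingProd (-m - 1 / 4 : K) r * (r + 1 / 4) * (quarterRatio K r / r.factorial) := by
    intro r
    induction r with
    | zero =>
      intro _
      simp [quarterRatio]
      field_simp
      ring
    | succ r ih =>
      intro hr
      have h1 := hK.three_quarters_add_ne (i := r) (by omega)
      have h2 := hK.succ_ne (j := r) (by omega)
      have h3 := hK.factorial_ne (k := r) (by omega)
      rw [sum_range_succ, ih (by omega), quarterRatio_succ, Nat.factorial_succ,
        risingProd_succ_left (-(m + 1 : ℕ) - 1 / 4 : K), risingProd_succ,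
        show (-(m + 1 : ℕ) - 1 / 4 + 1 : K) = -m - 1 / 4 by push_cast; ring]
      have h4 : (4 * r + 3 : K) ≠ 0 := by exact_mod_cast hK (4 * r + 3) (by omega) (by omega)
      rw [show (1 / 4 + r : K) / (3 / 4 + r) = (4 * r + 1) / (4 * r + 3) by
        rw [div_eq_div_iff h1 h4]; field_simp; ring]
      push_cast
      generalize risingProd (-m - 1 / 4 : K) r = a
      rw [mul_comm (4 : K)] at h4
      field_simp
      ring
  have h0 := key m le_rfl
  rw [sum_sub_distrib, ← mul_sum, ← mul_sum, ← quarterSum] at h0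
  have hw : risingProd (-m - 1 / 4 : K) m * (1 / 4) = (-1) ^ m * risingProd (1 / 4) (m + 1) := by
    rw [risingProd_succ_left, show (-m - 1 / 4 : K) = 1 - (1 / 4 + 1) - m by ring,
      risingProd_reflect]
    ring
  have h1 := hK.three_quarters_add_ne (i := m) (by omega)
  have h2 := hK.succ_ne (j := m) (by omega)
  have h3 := hK.factorial_ne (k := m) (by omega)
  have hq : (m + 1 / 4) * (quarterRatio K m / m.factorial) =
      (m + 1) * (m + 3 / 4) * (quarterRatio K (m + 1) / (m + 1).factorial) := by
    have h4 : (4 * m + 3 : K) ≠ 0 := by exact_mod_cast hK (4 * m + 3) (by omega) (by omega)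
    rw [quarterRatio_succ, Nat.factorial_succ, show (1 / 4 + m : K) / (3 / 4 + m) =
      (4 * m + 1) / (4 * m + 3) by rw [div_eq_div_iff h1 h4]; field_simp; ring]
    push_cast
    rw [mul_comm (4 : K)] at h4
    field_simp
  rw [quarterSum, sum_range_succ, mul_add, sub_eq_iff_eq_add.1 h0,
    risingProd_succ_left (-(m + 1 : ℕ) - 1 / 4 : K),
    show (-(m + 1 : ℕ) - 1 / 4 + 1 : K) = -m - 1 / 4 by push_cast; ring, mul_assoc _ (m + 1 / 4 : K),
    hq]
  have h5 : (4 : K) * (1 / 4) = 1 := by field_simp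
  push_cast
  rw [show risingProd (-m - 1 / 4 : K) m = 4 * ((-1) ^ m * risingProd (1 / 4) (m + 1)) by
    rw [← hw]; linear_combination -(risingProd (-m - 1 / 4 : K) m) * h5]
  rw [show (3 / 4 : K) = 1 - 1 / 4 by field_simp; norm_num]
  linear_combination (-2 : K) * ((-1) ^ m * risingProd (1 / 4) (m + 1)) * (m + 1) *
    (quarterRatio K (m + 1) / (m + 1).factorial) * h5

/-- A symmetric alternating well-poised sum in terms of a truncated `₃F₂`. -/
lemma alternating_sum_quarterRatio_sq (hK : CharAtLeast K p) {m : ℕ} (h : 4 * m ≤ p)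
    (hp : 2 < p) :
    risingProd (3 / 4) m *
      (1 + 2 * ∑ r ∈ range m, (-1) ^ (r + 1) * quarterRatio K (r + 1) ^ 2) =
      m.factorial * quarterSum K m := by
  induction m with
  | zero => simp [quarterSum, quarterRatio]
  | succ m ih =>
    have h1 := hK.risingProd_three_quarters_ne (k := m + 1) h
    have h2 := hK.factorial_ne (k := m + 1) (by omega)
    have h3 := ih (by omega)
    have hs := hK.quarterSum_succ (m := m) (by omega)
    have hq : risingProd (1 / 4 : K) (m + 1) =
        quarterRatio K (m + 1) * risingProd (3 / 4) (m + 1) := by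
      rw [quarterRatio, div_mul_cancel₀ _ h1]
    have hf : ((m + 1).factorial : K) = (m + 1) * m.factorial := by
      rw [Nat.factorial_succ]; push_cast; ring
    have hd : (m + 1).factorial * (quarterRatio K (m + 1) / (m + 1).factorial) =
        quarterRatio K (m + 1) := mul_div_cancel₀ _ h2
    rw [sum_range_succ]
    have hv := risingProd_succ (3 / 4 : K) m
    have e1 : ((m + 1).factorial : K) * quarterSum K (m + 1) =
        m.factorial * ((m + 1) * quarterSum K (m + 1)) := by rw [hf]; ring
    rw [e1, hs, hq]
    rw [hf] at hd ⊢
    linear_combination (3 / 4 + m : K) * h3 - 2 * (-1) ^ (m + 1) *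
      (quarterRatio K (m + 1) * risingProd (3 / 4) (m + 1)) * hd +
      (1 + 2 * ∑ r ∈ range m, (-1) ^ (r + 1) * quarterRatio K (r + 1) ^ 2) * hv

end CharAtLeast

lemma sum_range_two_mul_add_one (f : ℕ → K) (m : ℕ) :
    ∑ i ∈ range (2 * m + 1), f i =
      f m + ∑ r ∈ range m, (f (m + (r + 1)) + f (m - (r + 1))) := by
  rw [show 2 * m + 1 = m + (m + 1) by ring, sum_range_add, sum_range_succ' _ m, sum_add_distrib,
    ← sum_range_reflect f m, add_zero]
  rw [sum_congr rfl fun i (_ : i ∈ range m) => by rw [show m - 1 - i = m - (i + 1) by omega]]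
  ring

namespace CharAtLeast

/-- Here 2m = −3/2, so v_{m+r+1}/v_{m+r} = (2m+2r+2)/(2m+2r+3) becomes (4r+1)/(4r+3), and likewise
going down from m. -/
lemma dualRatio_add_sub (hK : CharAtLeast K p) {m : ℕ} (hp : p = 4 * m + 3)
    (h0 : (4 * m + 3 : K) = 0) : ∀ r ≤ m,
    dualRatio K (m + r) = dualRatio K m * quarterRatio K r ∧
      dualRatio K (m - r) = dualRatio K m * quarterRatio K r := by
  have hf := hK.four_ne (by omega)
  have h2 : (2 : K) ≠ 0 := by exact_mod_cast hK 2 (by omega) (by omega)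
  intro r
  induction r with
  | zero => simp [quarterRatio]
  | succ r ih =>
    intro hr
    obtain ⟨ih1, ih2⟩ := ih (by omega)
    have h1 := hK.three_quarters_add_ne (i := r) (by omega)
    have h4 : (4 * r + 3 : K) ≠ 0 := by exact_mod_cast hK (4 * r + 3) (by omega) (by omega)
    have h5 : (2 * (m + r : ℕ) + 3 : K) ≠ 0 := by
      exact_mod_cast hK (2 * (m + r) + 3) (by omega) (by omega)
    rw [quarterRatio_succ, ← mul_assoc]
    rw [show (1 / 4 + r : K) / (3 / 4 + r) = (4 * r + 1) / (4 * r + 3) by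
        rw [div_eq_div_iff h1 h4]; field_simp; ring]
    constructor
    · rw [← ih1, ← add_assoc, hK.dualRatio_succ (by omega)]
      congr 1
      rw [div_eq_div_iff h5 h4]
      push_cast
      linear_combination h0
    · rw [← ih2]
      obtain ⟨k, rfl⟩ : ∃ k, m = r + 1 + k := ⟨m - r - 1, by omega⟩
      rw [show r + 1 + k - (r + 1) = k by omega, show r + 1 + k - r = k + 1 by omega,
        hK.dualRatio_succ (by omega), mul_assoc]
      have h6 : (2 * k + 3 : K) ≠ 0 := by exact_mod_cast hK (2 * k + 3) (by omega) (by omega)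
      push_cast at h0
      rw [div_mul_div_comm, (div_eq_one_iff_eq (mul_ne_zero h6 h4)).2, mul_one]
      linear_combination (-1 : K) * h0

/-- The alternating sum of the squared dual ratios, when `(p - 1) / 2 = 2 m + 1` is odd. -/
lemma sum_neg_one_pow_dualRatio_sq (hK : CharAtLeast K p) {m : ℕ} (hp : p = 4 * m + 3)
    (h0 : (4 * m + 3 : K) = 0) :
    ∑ i ∈ range (2 * m + 1), (-1) ^ i * dualRatio K i ^ 2 =
      dualRatio K m * ∑ k ∈ range (m + 1), halfRatio K k * dualRatio K (m - k) := by
  have hf := hK.four_ne (by omega)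
  have h2 : (2 : K) ≠ 0 := by exact_mod_cast hK 2 (by omega) (by omega)
  -- This specialises −m − 1/4 to 1/2 and lets (3/4)_m be reflected into (−1)^m m!.
  have hm : (m : K) = -(3 / 4) := by field_simp; linear_combination h0
  have hv : risingProd (3 / 4 : K) m = (-1) ^ m * m.factorial := by
    have h1 : ∀ k : ℕ, risingProd (1 : K) k = k.factorial := by
      intro k
      induction k with
      | zero => simp
      | succ k ih => rw [risingProd_succ, ih, Nat.factorial_succ]; push_cast; ring
    rw [← h1, ← risingProd_reflect, hm]
    ring_nf
  have hhalf : ∀ k ≤ m, risingProd (-m - 1 / 4 : K) k = k.factorial * halfRatio K k := by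
    intro k
    induction k with
    | zero => simp
    | succ k ih =>
      intro hk
      have h3 := hK.succ_ne (j := k) (by omega)
      rw [risingProd_succ, ih (by omega), Nat.factorial_succ, halfRatio_succ, hm]
      push_cast
      field_simp
      ring
  have hq : quarterSum K m = ∑ k ∈ range (m + 1), halfRatio K k * quarterRatio K k := by
    refine sum_congr rfl fun k hk => ?_
    rw [mem_range] at hk
    have h3 := hK.factorial_ne (k := k) (by omega)
    rw [hhalf k (by omega)]
    field_simp
  have hF := hK.alternating_sum_quarterRatio_sq (m := m) (by omega) (by omega)
  rw [hv, hq] at hF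
  have hF' : (-1) ^ m * (1 + 2 * ∑ r ∈ range m, (-1) ^ (r + 1) * quarterRatio K (r + 1) ^ 2) =
      ∑ k ∈ range (m + 1), halfRatio K k * quarterRatio K k :=
    mul_left_cancel₀ (hK.factorial_ne (k := m) (by omega)) (by linear_combination hF)
  have hc : ∑ k ∈ range (m + 1), halfRatio K k * dualRatio K (m - k) =
      dualRatio K m * ∑ k ∈ range (m + 1), halfRatio K k * quarterRatio K k := by
    rw [mul_sum]
    refine sum_congr rfl fun k hk => ?_
    rw [mem_range] at hk
    rw [(hK.dualRatio_add_sub hp h0 k (by omega)).2]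
    ring
  rw [hc, ← hF', sum_range_two_mul_add_one]
  have hr : ∀ r ∈ range m, (-1) ^ (m + (r + 1)) * dualRatio K (m + (r + 1)) ^ 2 +
      (-1) ^ (m - (r + 1)) * dualRatio K (m - (r + 1)) ^ 2 =
      (-1) ^ m * dualRatio K m ^ 2 * 2 * ((-1) ^ (r + 1) * quarterRatio K (r + 1) ^ 2) := by
    intro r hr
    rw [mem_range] at hr
    obtain ⟨e1, e2⟩ := hK.dualRatio_add_sub hp h0 (r + 1) (by omega)
    rw [e1, e2]
    have : (-1 : K) ^ (m - (r + 1)) = (-1) ^ m * (-1) ^ (r + 1) := by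
      obtain ⟨k, rfl⟩ : ∃ k, m = r + 1 + k := ⟨m - r - 1, by omega⟩
      rw [show r + 1 + k - (r + 1) = k by omega, pow_add _ (r + 1) k, mul_right_comm, ← mul_pow]
      simp
    rw [this, pow_add (-1 : K) m]
    ring
  rw [sum_congr rfl hr, ← mul_sum]
  ring

end CharAtLeast
end Quarter

/-! ### The Green polynomial dual to evaluation at −1 -/

section Green

variable {K : Type*} [Field K] {p : ℕ}

/-- The coefficients of a polynomial `h` of degree below `2 n + 1` with
`(k + 1)² h_{k+1} - (k + 1/2)² h_k = (-1)^k`, where `2 n + 1 = 0` in `K`. -/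
def greenCoeff (K : Type*) [Field K] (n k : ℕ) : K :=
  if k ≤ n then
    halfRatio K k ^ 2 * (∑ j ∈ range k, (-1) ^ j * dualRatio K j ^ 2 -
      (∑ j ∈ range n, (-1) ^ j * dualRatio K j ^ 2) / 2)
  else
    -(dualRatio K (k - (n + 1)) ^ 2 * ∑ j ∈ range (k - n), (-1) ^ j * halfRatio K j ^ 2)

namespace CharAtLeast

/-- u_k = (−1)^k binom(−1/2, k), and n = −1/2 in `K`. -/
lemma halfRatio_eq_choose (hK : CharAtLeast K p) {n : ℕ} (hp : p = 2 * n + 1)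
    (h0 : (2 * n + 1 : K) = 0) : ∀ k ≤ n, halfRatio K k = (-1) ^ k * n.choose k := by
  intro k
  induction k with
  | zero => simp
  | succ k ih =>
    intro hk
    have h2 := hK.even_ne (j := k) (by omega)
    have hc : (n.choose (k + 1) : K) * (k + 1) = n.choose k * (n - k) := by
      rw [← Nat.cast_sub (by omega)]
      simpa using congrArg (Nat.cast : ℕ → K) (Nat.choose_succ_right_eq n k)
    rw [halfRatio_succ, ih (by omega), ← mul_div_assoc, div_eq_iff h2, pow_succ]
    linear_combination 2 * (-1 : K) ^ k * hc + (-1 : K) ^ k * n.choose k * h0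

lemma halfRatio_reflect (hK : CharAtLeast K p) {n : ℕ} (hp : p = 2 * n + 1)
    (h0 : (2 * n + 1 : K) = 0) (hn : Odd n) {k : ℕ} (hk : k ≤ n) :
    halfRatio K (n - k) = -halfRatio K k := by
  rw [hK.halfRatio_eq_choose hp h0 _ (by omega), hK.halfRatio_eq_choose hp h0 _ hk,
    Nat.choose_symm hk]
  obtain ⟨j, rfl⟩ : ∃ j, n = k + j := ⟨n - k, by omega⟩
  have h1 := hn.neg_one_pow (α := K)
  have h2 : (-1 : K) ^ k * (-1) ^ k = 1 := by rw [← mul_pow]; simp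
  rw [pow_add] at h1
  rw [show k + j - k = j by omega]
  linear_combination ((k + j).choose k : K) * ((-1 : K) ^ k * h1 - (-1 : K) ^ j * h2)

lemma dualRatio_reflect (hK : CharAtLeast K p) {n : ℕ} (hp : p = 2 * n + 1)
    (h0 : (2 * n + 1 : K) = 0) (hn : Odd n) {i : ℕ} (hi : i < n) :
    dualRatio K (n - 1 - i) = dualRatio K i := by
  have h1 := hK.halfRatio_reflect hp h0 hn (k := i + 1) (by omega)
  have h2 := hK.even_ne (j := i) (by omega)
  rw [dualRatio, dualRatio, show n - 1 - i = n - (i + 1) by omega, h1, Nat.cast_sub (by omega),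
    halfRatio_succ]
  congr 1
  rw [mul_neg, ← mul_div_assoc, ← mul_div_assoc, ← neg_div, div_eq_iff h2]
  push_cast
  linear_combination (-halfRatio K i * (2 * i + 1)) * h0

/-- Variation of constants: u_k² solves the homogeneous recurrence below n, and v_{k−n−1}² solves it
above n. The halves decouple at k = n, where k + 1/2 = 0. -/
lemma greenCoeff_rec (hK : CharAtLeast K p) {n : ℕ} (hp : p = 2 * n + 1)
    (h0 : (2 * n + 1 : K) = 0) (hn : Odd n) {k : ℕ} (hk : k < p) :
    (k + 1 : K) ^ 2 * greenCoeff K n (k + 1) - (k + 1 / 2 : K) ^ 2 * greenCoeff K n k =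
      (-1) ^ k := by
  have hn1 : 0 < n := hn.pos
  have h2 : (2 : K) ≠ 0 := by exact_mod_cast hK 2 (by omega) (by omega)
  rcases lt_trichotomy k n with h | rfl | h
  · rw [greenCoeff, greenCoeff, if_pos (by omega), if_pos h.le, sum_range_succ, halfRatio_succ]
    have h3 := hK.halfRatio_mul_dualRatio (i := k) (by omega)
    have h4 := hK.succ_ne (j := k) (by omega)
    have h5 := hK.odd_ne (j := k) (by omega)
    have h6 : (2 * k + 1) * (halfRatio K k * dualRatio K k) = 2 := by
      rw [h3]; field_simp
    have h7 : (k + 1 : K) * ((2 * k + 1) / (2 * k + 2)) = k + 1 / 2 := by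
      field_simp
    generalize ∑ j ∈ range k, (-1) ^ j * dualRatio K j ^ 2 = a
    generalize ∑ j ∈ range n, (-1) ^ j * dualRatio K j ^ 2 = b
    generalize halfRatio K k = x at *
    generalize dualRatio K k = y at *
    calc _ = ((k + 1 : K) * ((2 * k + 1) / (2 * k + 2))) ^ 2 * (x ^ 2 *
          (a + (-1) ^ k * y ^ 2 - b / 2)) - (k + 1 / 2 : K) ^ 2 * (x ^ 2 * (a - b / 2)) := by ring
      _ = (-1) ^ k * ((2 * k + 1) * (x * y)) ^ 2 / 2 ^ 2 := by
        rw [h7]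
        field_simp
        ring
      _ = _ := by rw [h6]; field_simp
  · rw [greenCoeff, if_neg (by omega), show k + 1 - (k + 1) = 0 by omega,
      show k + 1 - k = 1 by omega, hn.neg_one_pow]
    simp only [dualRatio_zero, sum_range_one, pow_zero, halfRatio_zero]
    have h3 : (k + 1 / 2 : K) = 0 := by field_simp; linear_combination h0
    rw [h3]
    have h4 : (k + 1 : K) = 1 / 2 := by field_simp; linear_combination h0
    rw [h4]
    field_simp
    norm_num
  · obtain ⟨i, rfl⟩ : ∃ i, k = n + 1 + i := ⟨k - n - 1, by omega⟩
    rw [greenCoeff, greenCoeff, if_neg (by omega), if_neg (by omega),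
      show n + 1 + i + 1 - (n + 1) = i + 1 by omega, show n + 1 + i - (n + 1) = i by omega,
      show n + 1 + i + 1 - n = i + 1 + 1 by omega, show n + 1 + i - n = i + 1 by omega,
      sum_range_succ _ (i + 1), pow_add (-1 : K) (n + 1), hn.add_one.neg_one_pow, one_mul]
    have h3 : ((n + 1 + i : ℕ) + 1 / 2 : K) = i + 1 := by
      push_cast; field_simp; linear_combination h0
    have h4 : ((n + 1 + i : ℕ) + 1 : K) = (2 * i + 3) / 2 := by
      push_cast; field_simp; linear_combination h0
    rw [h3, h4]
    have h5 := hK.succ_ne (j := i) (by omega)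
    have h8 := hK.halfRatio_mul_dualRatio (i := i) (by omega)
    have h9 : (i * 2 + 1 : K) ≠ 0 := by rw [mul_comm]; exact hK.odd_ne (by omega)
    have h10 : (i + 1) * dualRatio K i * halfRatio K (i + 1) = 1 := by
      rw [halfRatio_succ]
      calc _ = (i + 1) * (halfRatio K i * dualRatio K i) * ((2 * i + 1) / (2 * i + 2)) := by ring
        _ = 1 := by rw [h8]; field_simp
    rcases eq_or_ne (i + 1) n with rfl | hi
    · have h6 : (2 * i + 3 : K) = 0 := by push_cast at h0; linear_combination h0
      -- Here k = p − 1 and (k + 1)² = 0, so the recurrence is a closing condition, met because the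
      -- full alternating sum of u_j² vanishes.
      have h7 := hK.sum_range_neg_one_pow_symm_eq_zero (by omega) hn
        (f := fun j => halfRatio K j ^ 2) fun j hj => by
          rw [hK.halfRatio_reflect hp h0 hn hj, neg_sq]
      rw [sum_range_succ] at h7
      rw [h6, eq_neg_of_add_eq_zero_left h7]
      rw [pow_succ]
      linear_combination ((-1) ^ i * ((i + 1) * dualRatio K i * halfRatio K (i + 1) + 1)) * h10
    · have h6 := hK.dualRatio_succ (i := i) (by omega)
      have h7 : (2 * i + 3 : K) ≠ 0 := by exact_mod_cast hK (2 * i + 3) (by omega) (by omega)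
      have h11 : (2 * i + 3 : K) / 2 * dualRatio K (i + 1) = (i + 1) * dualRatio K i := by
        rw [h6, mul_left_comm, div_mul_div_cancel₀' h7]
        field_simp
      rw [pow_succ (-1 : K)]
      linear_combination -(((2 * i + 3 : K) / 2 * dualRatio K (i + 1) + (i + 1) * dualRatio K i) *
        (∑ j ∈ range (i + 1), (-1) ^ j * halfRatio K j ^ 2 +
          (-1) ^ i * (-1) * halfRatio K (i + 1) ^ 2)) * h11 +
        (-1) ^ i * ((i + 1) * dualRatio K i * halfRatio K (i + 1) + 1) * h10

lemma greenCoeff_sum (hK : CharAtLeast K p) {m : ℕ} (hp : p = 4 * m + 3)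
    (h0 : (4 * m + 3 : K) = 0) :
    greenCoeff K (2 * m + 1) 0 + ∑ k ∈ range p, greenCoeff K (2 * m + 1) k = 0 := by
  have h2 : (2 : K) ≠ 0 := by exact_mod_cast hK 2 (by omega) (by omega)
  have hn : Odd (2 * m + 1) := ⟨m, rfl⟩
  have hodd := hK.odd_mul_weightedLegendreSum (m := m) (by omega)
  have hdual := hK.sum_neg_one_pow_dualRatio_sq hp h0
  have hmid := hK.halfRatio_mul_dualRatio (i := m) (by omega)
  have hm1 := hK.odd_ne (j := m) (by omega)
  have hE : ∑ i ∈ range (2 * m + 1), (-1) ^ i * dualRatio K i ^ 2 =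
      2 * weightedLegendreSum K (2 * m + 1) := by
    rw [hdual, ← hodd]
    have : (2 * m + 1) * (halfRatio K m * dualRatio K m) = 2 := by rw [hmid]; field_simp
    linear_combination weightedLegendreSum K (2 * m + 1) * this
  set n := 2 * m + 1 with hndef
  have hp' : p = 2 * n + 1 := by omega
  have h0' : (2 * n + 1 : K) = 0 := by rw [hndef]; push_cast; linear_combination h0
  have hw : weightedLegendreSum K n =
      -∑ i ∈ range n, dualRatio K i ^ 2 * ∑ j ∈ range (i + 1), (-1) ^ j * halfRatio K j ^ 2 := by
    rw [weightedLegendreSum, ← sum_neg_distrib]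
    refine sum_congr rfl fun i hi => ?_
    rw [mem_range] at hi
    rw [hK.dualRatio_reflect hp' h0' hn hi, ← sq, ← mul_neg, ← sum_neg_distrib]
    congr 1
    refine sum_congr rfl fun j hj => ?_
    rw [mem_range] at hj
    rw [legendreCoeff, hK.halfRatio_reflect hp' h0' hn (by omega)]
    ring
  -- The constant −S/2 in `greenCoeff` makes the lower half antisymmetric under k ↦ n − k.
  have hlow : ∑ k ∈ range (n + 1), greenCoeff K n k = 0 := by
    have hrefl : ∀ k ∈ range (n + 1), greenCoeff K n (n + 1 - 1 - k) = -greenCoeff K n k := by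
      intro k hk
      rw [mem_range] at hk
      obtain ⟨l, hl⟩ : ∃ l, n = k + l := ⟨n - k, by omega⟩
      rw [greenCoeff, greenCoeff, if_pos (by omega), if_pos (by omega),
        show n + 1 - 1 - k = n - k by omega, hK.halfRatio_reflect hp' h0' hn (by omega)]
      have hs : ∑ j ∈ range (n - k), (-1) ^ j * dualRatio K j ^ 2 =
          ∑ j ∈ range n, (-1) ^ j * dualRatio K j ^ 2 -
            ∑ j ∈ range k, (-1) ^ j * dualRatio K j ^ 2 := by
        have hr : ∀ j ∈ range n, (-1) ^ (n - 1 - j) * dualRatio K (n - 1 - j) ^ 2 =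
            (-1) ^ j * dualRatio K j ^ 2 := by
          intro j hj
          rw [mem_range] at hj
          rw [hK.dualRatio_reflect hp' h0' hn hj]
          congr 1
          rw [neg_one_pow_eq_pow_mod_two, neg_one_pow_eq_pow_mod_two (n := j)]
          congr 1
          omega
        rw [eq_sub_iff_add_eq]
        have e1 : ∑ j ∈ range k, (-1) ^ j * dualRatio K j ^ 2 =
            ∑ j ∈ range k, (-1) ^ (n - k + j) * dualRatio K (n - k + j) ^ 2 := by
          rw [← sum_range_reflect]
          refine sum_congr rfl fun j hj => ?_
          rw [mem_range] at hj
          rw [← hr (k - 1 - j) (by rw [mem_range]; omega),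
            show n - 1 - (k - 1 - j) = n - k + j by omega]
        rw [e1, ← sum_range_add, show n - k + k = n by omega]
      rw [hs]
      field_simp
      ring
    have h1 := sum_range_reflect (greenCoeff K n) (n + 1)
    rw [sum_congr rfl hrefl, sum_neg_distrib] at h1
    have : 2 * ∑ k ∈ range (n + 1), greenCoeff K n k = 0 := by linear_combination -h1
    exact (mul_eq_zero.1 this).resolve_left h2
  rw [show p = n + 1 + n by omega, sum_range_add, hlow, zero_add]
  have hhigh : ∑ k ∈ range n, greenCoeff K n (n + 1 + k) = weightedLegendreSum K n := by
    rw [hw, ← sum_neg_distrib]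
    refine sum_congr rfl fun k _ => ?_
    rw [greenCoeff, if_neg (by omega), show n + 1 + k - (n + 1) = k by omega,
      show n + 1 + k - n = k + 1 by omega]
  rw [hhigh, greenCoeff, if_pos (by omega), hE]
  simp
  field_simp
  ring

end CharAtLeast
end Green

/-! ### The hypergeometric operator and its self-adjointness mod p -/

section Operator

open Polynomial

variable {K : Type*} [Field K] {p : ℕ}

/-- The hypergeometric operator of the Legendre family of elliptic curves. -/
noncomputable def legendreOp (f : K[X]) : K[X] :=
  X * (1 - X) * derivative (derivative f) + (1 - 2 * X) * derivative f - C (1 / 4) * f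

lemma coeff_legendreOp (h2 : (2 : K) ≠ 0) (f : K[X]) (k : ℕ) :
    (legendreOp f).coeff k =
      (k + 1 : K) ^ 2 * f.coeff (k + 1) - (k + 1 / 2 : K) ^ 2 * f.coeff k := by
  have h : legendreOp f = X * derivative (derivative f) - X * (X * derivative (derivative f)) +
      derivative f - C 2 * (X * derivative f) - C (1 / 4) * f := by
    rw [legendreOp, show (2 : K[X]) = C 2 from rfl]
    ring
  have h4 : (4 : K) = 2 * 2 := by norm_num
  rw [h]
  rcases k with _ | _ | k <;>
    simp only [coeff_add, coeff_sub, coeff_C_mul, coeff_X_mul, coeff_X_mul_zero,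
      coeff_derivative] <;> push_cast <;> rw [h4] <;> field_simp <;> ring

lemma legendreOp_add (f g : K[X]) : legendreOp (f + g) = legendreOp f + legendreOp g := by
  simp only [legendreOp, derivative_add]
  ring

lemma legendreOp_comp (f : K[X]) :
    legendreOp (f.comp (1 - X)) = (legendreOp f).comp (1 - X) := by
  simp [legendreOp, derivative_comp]
  ring

/-- The difference of the two sides telescopes through k² f_k h_{p−k}, which vanishes at k = 0 and
at k = p. -/
lemma sum_legendre_pairing (h2 : (2 : K) ≠ 0) (h0 : (p : K) = 0) (hp : 0 < p) (f h : ℕ → K) :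
    ∑ k ∈ range p, ((k + 1 : K) ^ 2 * f (k + 1) - (k + 1 / 2 : K) ^ 2 * f k) * h (p - 1 - k) =
      ∑ k ∈ range p, f k * (((p - 1 - k : ℕ) + 1 : K) ^ 2 * h (p - 1 - k + 1) -
        ((p - 1 - k : ℕ) + 1 / 2 : K) ^ 2 * h (p - 1 - k)) := by
  have h1 := sum_range_succ (fun k : ℕ => (k : K) ^ 2 * f k * h (p - k)) p
  rw [sum_range_succ', h0] at h1
  simp only [Nat.cast_zero, zero_mul, ne_eq, OfNat.ofNat_ne_zero, not_false_eq_true, zero_pow,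
    add_zero, Nat.cast_add, Nat.cast_one] at h1
  rw [← sub_eq_zero, ← sum_sub_distrib]
  rw [← sub_eq_zero, ← sum_sub_distrib] at h1
  rw [← h1]
  refine sum_congr rfl fun k hk => ?_
  rw [mem_range] at hk
  obtain ⟨l, rfl⟩ : ∃ l, p = k + 1 + l := ⟨p - k - 1, by omega⟩
  rw [show k + 1 + l - 1 - k = l by omega, show k + 1 + l - (k + 1) = l by omega,
    show k + 1 + l - k = l + 1 by omega]
  have hl : (l : K) = -(k + 1) := by push_cast at h0; linear_combination h0
  rw [hl]
  have : (1 / 2 : K) + 1 / 2 = 1 := by field_simp; norm_num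
  linear_combination (f k * h l) * (-(2 * k + 1)) * this

lemma one_sub_X_pow_char_sub_one [CharP K p] (hp : p.Prime) :
    (1 - X : K[X]) ^ (p - 1) = ∑ k ∈ range p, X ^ k := by
  have : Fact p.Prime := ⟨hp⟩
  have h1 : (1 - X : K[X]) ≠ 0 := by
    intro h
    simpa using congrArg (eval 0) h
  apply mul_left_cancel₀ h1
  rw [mul_neg_geom_sum, mul_comm, pow_sub_one_mul hp.ne_zero, sub_pow_char, one_pow]

/-- The perturbation coefficients of the truncated period of the Legendre family sum to zero at
the pair of points `2` and `-1`. -/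
theorem sum_mul_two_pow_add_neg_one_pow [CharP K p] (hp : p.Prime) (hp4 : p % 4 = 3)
    (B : K[X]) (hB : B.comp (1 - X) = -B) (hdeg : B.natDegree < p - 1) (e : ℕ → K)
    (he : ∀ k, k + 1 < p →
      (k + 1 : K) ^ 2 * e (k + 1) = (k + 1 / 2 : K) ^ 2 * e k + B.coeff k / 4) :
    ∑ k ∈ range p, e k * (2 ^ k + (-1) ^ k) = 0 := by
  obtain ⟨m, hm⟩ : ∃ m, p = 4 * m + 3 := ⟨p / 4, by omega⟩
  have h0 : (p : K) = 0 := CharP.cast_eq_zero K p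
  have hK : CharAtLeast K p := fun i hi hip h =>
    absurd (Nat.le_of_dvd hi ((CharP.cast_eq_zero_iff K p i).1 h)) (by omega)
  have h2 : (2 : K) ≠ 0 := by exact_mod_cast hK 2 (by omega) (by omega)
  have h4 := hK.four_ne (by omega)
  have h0m : (4 * m + 3 : K) = 0 := by rw [← h0, hm]; push_cast; ring
  set n := 2 * m + 1 with hn
  have h0n : (2 * n + 1 : K) = 0 := by rw [← h0m, hn]; push_cast; ring
  have hrec : ∀ k < p, (k + 1 : K) ^ 2 * greenCoeff K n (k + 1) -
      (k + 1 / 2 : K) ^ 2 * greenCoeff K n k = (-1) ^ k := fun k hk =>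
    hK.greenCoeff_rec (by omega) h0n ⟨m, hn⟩ hk
  have hsum := hK.greenCoeff_sum hm h0m
  set E : K[X] := ∑ k ∈ range p, C (e k) * X ^ k with hE
  have hEc : ∀ k, E.coeff k = if k < p then e k else 0 := by
    intro k
    simp [hE, finsetSum_coeff, coeff_C_mul, coeff_X_pow]
  have hEdeg : E.natDegree < p := by
    refine lt_of_le_of_lt (natDegree_le_iff_coeff_eq_zero.2 fun k hk => ?_)
      (Nat.sub_lt hp.pos one_pos)
    rw [hEc, if_neg (by omega)]
  obtain ⟨c, hc⟩ : ∃ c : K, legendreOp E = C (1 / 4) * B + C c * X ^ (p - 1) := by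
    -- Truncating E below degree p leaves only this error, in degree p − 1.
    refine ⟨-((p - 1 : ℕ) + 1 / 2 : K) ^ 2 * e (p - 1), ?_⟩
    ext k
    rw [coeff_legendreOp h2, coeff_add, coeff_C_mul, coeff_C_mul, coeff_X_pow, hEc, hEc]
    rcases lt_trichotomy k (p - 1) with h | h | h
    · rw [if_pos (by omega), if_pos (by omega), if_neg (by omega), he k (by omega)]
      ring
    · rw [if_neg (by omega), if_pos (by omega), if_pos h, h,
        coeff_eq_zero_of_natDegree_lt hdeg]
      ring
    · rw [if_neg (by omega), if_neg (by omega), if_neg (by omega),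
        coeff_eq_zero_of_natDegree_lt (hdeg.trans h)]
      ring
  set G : K[X] := E + E.comp (1 - X) with hG
  have hGdeg : G.natDegree < p := by
    refine lt_of_le_of_lt (natDegree_add_le _ _) (max_lt hEdeg (lt_of_le_of_lt natDegree_comp_le ?_))
    have : (1 - X : K[X]).natDegree ≤ 1 := by compute_degree
    nlinarith
  have hGop : legendreOp G = C c * (X ^ (p - 1) + ∑ k ∈ range p, X ^ k) := by
    rw [hG, legendreOp_add, legendreOp_comp, hc, ← one_sub_X_pow_char_sub_one hp]
    simp [hB]
    ring
  have hGc : ∀ k < p, (k + 1 : K) ^ 2 * G.coeff (k + 1) - (k + 1 / 2 : K) ^ 2 * G.coeff k =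
      c * ((if k = p - 1 then 1 else 0) + 1) := by
    intro k hk
    rw [← coeff_legendreOp h2, hGop, coeff_C_mul, coeff_add, coeff_X_pow, finsetSum_coeff]
    simp [coeff_X_pow, hk]
  have hpair := sum_legendre_pairing h2 h0 hp.pos G.coeff (greenCoeff K n)
  have hl : ∑ k ∈ range p, ((k + 1 : K) ^ 2 * G.coeff (k + 1) - (k + 1 / 2 : K) ^ 2 * G.coeff k) *
      greenCoeff K n (p - 1 - k) = 0 := by
    rw [sum_congr rfl fun k hk => by rw [hGc k (mem_range.1 hk), mul_assoc, add_mul, one_mul],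
      ← mul_sum, sum_add_distrib, sum_range_reflect (greenCoeff K n) p]
    simp only [ite_mul, one_mul, zero_mul, sum_ite_eq', mem_range]
    rw [if_pos (by omega), Nat.sub_self, hsum, mul_zero]
  -- The dual side is ∑ G_k (−1)^(p−1−k), and p − 1 is even.
  have hr : G.eval (-1) = 0 := by
    rw [eval_eq_sum_range' hGdeg, ← hl, hpair]
    refine sum_congr rfl fun k hk => ?_
    rw [mem_range] at hk
    rw [hrec _ (by omega)]
    congr 1
    rw [neg_one_pow_eq_pow_mod_two, neg_one_pow_eq_pow_mod_two (n := p - 1 - k)]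
    congr 1
    omega
  have hev : ∀ x : K, E.eval x = ∑ k ∈ range p, e k * x ^ k := by
    intro x
    simp [hE, eval_finsetSum]
  rw [hG, eval_add, eval_comp, hev, hev] at hr
  simp only [mul_add, sum_add_distrib]
  rw [← hr, add_comm]
  congr 1
  refine sum_congr rfl fun k _ => ?_
  congr 2
  simp
  norm_num

end Operator

/-! ### Comparison with the shifted Legendre polynomial and descent to rationals -/

section Congruence

open Polynomial

lemma shiftedLegendre_coeff_succ (n k : ℕ) :
    ((k : ℤ) + 1) ^ 2 * (shiftedLegendre n).coeff (k + 1) =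
      -((n - k) * (n + k + 1) * (shiftedLegendre n).coeff k) := by
  rw [coeff_shiftedLegendre, coeff_shiftedLegendre]
  have h1 : (n.choose (k + 1) : ℤ) * (k + 1) = n.choose k * (n - k) := by
    rcases le_or_gt k n with h | h
    · have := congrArg (Nat.cast : ℕ → ℤ) (Nat.choose_succ_right_eq n k)
      push_cast [h] at this
      exact this
    · simp [Nat.choose_eq_zero_of_lt h, Nat.choose_eq_zero_of_lt (h.trans (Nat.lt_succ_self k))]
  have h2 : ((n + (k + 1)).choose n : ℤ) * (k + 1) = (n + k).choose n * (n + k + 1) := by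
    rw [Nat.choose_symm_add, Nat.choose_symm_add]
    have := congrArg (Nat.cast : ℕ → ℤ) (Nat.add_one_mul_choose_eq (n + k) k)
    push_cast at this
    rw [← add_assoc]
    linear_combination -this
  rw [pow_succ]
  linear_combination (-(-1 : ℤ) ^ k * (k + 1) * ((n + (k + 1)).choose n)) * h1 -
    (-1 : ℤ) ^ k * n.choose k * (n - k) * h2

/-- The numerators of the difference between `binom (2k) k ^ 2 / 16 ^ k` and the `k`-th coefficient
of the shifted Legendre polynomial of degree `n`, divided by `(2 n + 1) ^ 2`. -/
noncomputable def legendreDefect (n : ℕ) : ℕ → ℤ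
  | 0 => 0
  | k + 1 => (2 * k + 1) ^ 2 * legendreDefect n k +
      4 ^ k * (k.factorial : ℤ) ^ 2 * (shiftedLegendre n).coeff k

/-- Since (n−k)(n+k+1) = (n+1/2)² − (k+1/2)², the recurrences of a_k and b_k differ only by the term
(2n+1)² b_k/4. -/
lemma centralBinom_sq_sub_shiftedLegendre_coeff (n k : ℕ) :
    (((2 * k).choose k : ℚ) ^ 2 / 16 ^ k - (shiftedLegendre n).coeff k) *
      (4 ^ k * (k.factorial : ℚ) ^ 2) = (2 * n + 1) ^ 2 * legendreDefect n k := by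
  induction k with
  | zero => simp [legendreDefect, coeff_shiftedLegendre]
  | succ k ih =>
    have h1 : ((k : ℚ) + 1) * (2 * (k + 1)).choose (k + 1) = 2 * (2 * k + 1) * (2 * k).choose k := by
      exact_mod_cast Nat.succ_mul_centralBinom_succ k
    have h2 : ((k : ℚ) + 1) ^ 2 * (shiftedLegendre n).coeff (k + 1) =
        -((n - k) * (n + k + 1) * (shiftedLegendre n).coeff k) := by
      exact_mod_cast shiftedLegendre_coeff_succ n k
    have h3 : (((k : ℚ) + 1) * (2 * (k + 1)).choose (k + 1)) ^ 2 / 16 ^ (k + 1) =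
        (2 * k + 1) ^ 2 / 4 * (((2 * k).choose k : ℚ) ^ 2 / 16 ^ k) := by
      rw [h1, pow_succ (16 : ℚ)]
      field_simp
      ring
    rw [legendreDefect, Nat.factorial_succ]
    push_cast
    have e : (((2 * (k + 1)).choose (k + 1) : ℚ) ^ 2 / 16 ^ (k + 1) -
        (shiftedLegendre n).coeff (k + 1)) * (4 ^ (k + 1) * ((k + 1) * k.factorial : ℚ) ^ 2) =
        4 ^ (k + 1) * (k.factorial : ℚ) ^ 2 *
          ((((k : ℚ) + 1) * (2 * (k + 1)).choose (k + 1)) ^ 2 / 16 ^ (k + 1) -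
          ((k : ℚ) + 1) ^ 2 * (shiftedLegendre n).coeff (k + 1)) := by ring
    rw [e, h2, h3]
    rw [pow_succ (4 : ℚ)]
    linear_combination (2 * k + 1 : ℚ) ^ 2 * ih

/-- A sum of fractions with denominators prime to `p` that vanishes in `ZMod p` is `p` times a
fraction with denominator prime to `p`. -/
lemma exists_sum_div_eq_mul {p : ℕ} [Fact p.Prime] (x : ℕ → ℤ) (d : ℕ → ℕ) (s : ℕ)
    (hd : ∀ k < s, (d k).Coprime p)
    (h : ∑ k ∈ range s, (x k : ZMod p) / (d k : ZMod p) = 0) :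
    ∃ r : ℚ, r.den.Coprime p ∧ ∑ k ∈ range s, (x k : ℚ) / d k = p * r := by
  have hz : ∀ e : ℕ, e.Coprime p → (e : ZMod p) ≠ 0 ∧ (e : ℚ) ≠ 0 := by
    intro e he
    have : ¬ p ∣ e := (Nat.Prime.coprime_iff_not_dvd Fact.out).1 he.symm
    refine ⟨fun h0 => this ((ZMod.natCast_eq_zero_iff _ _).1 h0), fun h0 => this ?_⟩
    rw [Nat.cast_eq_zero.1 h0]
    exact dvd_zero p
  have key : ∀ t ≤ s, ∃ (M : ℤ) (D : ℕ), D.Coprime p ∧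
      ∑ k ∈ range t, (x k : ℚ) / d k = M / D ∧
      ∑ k ∈ range t, (x k : ZMod p) / (d k : ZMod p) = M / D := by
    intro t
    induction t with
    | zero => exact fun _ => ⟨0, 1, by simp⟩
    | succ t ih =>
      intro ht
      obtain ⟨M, D, hD, h1, h2⟩ := ih (by omega)
      have hdt := hd t (by omega)
      refine ⟨M * d t + D * x t, D * d t, Nat.Coprime.mul_left hD hdt, ?_, ?_⟩
      · rw [sum_range_succ, h1, div_add_div _ _ (hz _ hD).2 (hz _ hdt).2]
        push_cast
        ring
      · rw [sum_range_succ, h2, div_add_div _ _ (hz _ hD).1 (hz _ hdt).1]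
        push_cast
        ring
  obtain ⟨M, D, hD, h1, h2⟩ := key s le_rfl
  rw [h, eq_comm, div_eq_zero_iff, or_iff_left (hz _ hD).1, ZMod.intCast_zmod_eq_zero_iff_dvd] at h2
  obtain ⟨c, rfl⟩ := h2
  refine ⟨(c : ℚ) / (D : ℤ), ?_, ?_⟩
  · refine Nat.Coprime.coprime_dvd_left ?_ hD
    exact_mod_cast Rat.den_dvd c D
  · rw [h1]
    push_cast
    ring

theorem theorem1p1 (p : ℕ) (hp : p.Prime) (hp4 : p % 4 = 3) :
    RatModEq (p ^ 3)
      (∑ k ∈ Finset.range p, ((Nat.choose (2 * k) k : ℚ) ^ 2) / (8 : ℚ) ^ k)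
      (-∑ k ∈ Finset.range p, ((Nat.choose (2 * k) k : ℚ) ^ 2) / (-16 : ℚ) ^ k) := by
  have : Fact p.Prime := ⟨hp⟩
  obtain ⟨m, hm⟩ : ∃ m, p = 4 * m + 3 := ⟨p / 4, by omega⟩
  set n := 2 * m + 1 with hn
  have hodd : Odd n := ⟨m, hn⟩
  have hpn : p = 2 * n + 1 := by omega
  have hK : CharAtLeast (ZMod p) p := fun i hi hip h =>
    absurd (Nat.le_of_dvd hi ((ZMod.natCast_eq_zero_iff i p).1 h)) (by omega)
  have h2 : (2 : ZMod p) ≠ 0 := by exact_mod_cast hK 2 (by omega) (by omega)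
  have h4 := hK.four_ne (by omega)
  have hsymm : (shiftedLegendre n).comp (1 - X) = -shiftedLegendre n := by
    have := neg_one_pow_mul_shiftedLegendre_comp_one_sub_X_eq n
    rw [hodd.neg_one_pow] at this
    linear_combination -this
  have hmod := sum_mul_two_pow_add_neg_one_pow (K := ZMod p) hp hp4
    ((shiftedLegendre n).map (Int.castRingHom (ZMod p)))
    (by
      have := congrArg (Polynomial.map (Int.castRingHom (ZMod p))) hsymm
      simpa [Polynomial.map_comp] using this)
    (lt_of_le_of_lt natDegree_map_le (by rw [natDegree_shiftedLegendre]; omega))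
    (fun k => (legendreDefect n k : ZMod p) / (4 ^ k * (k.factorial : ZMod p) ^ 2))
    (by
      intro k hk
      have hf := hK.factorial_ne (k := k) (by omega)
      have hs := hK.succ_ne hk
      simp only [legendreDefect, Nat.factorial_succ, coeff_map, eq_intCast]
      push_cast
      rw [pow_succ (4 : ZMod p)]
      field_simp
      rw [show (4 : ZMod p) = 2 ^ 2 by norm_num]
      ring)
  obtain ⟨r, hr, hsum⟩ := exists_sum_div_eq_mul (p := p)
    (fun k => legendreDefect n k * (2 ^ k + (-1) ^ k)) (fun k => 4 ^ k * k.factorial ^ 2) p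
    (fun k hk => by
      refine Nat.Coprime.mul_left (Nat.Coprime.pow_left _ ?_) (Nat.Coprime.pow_left _ ?_)
      · have : Nat.Coprime 2 p := (Nat.coprime_primes Nat.prime_two hp).2 (by omega)
        exact Nat.Coprime.pow_left 2 this
      · exact ((hp.coprime_factorial_of_lt hk).symm))
    (by
      rw [← hmod]
      refine sum_congr rfl fun k _ => ?_
      push_cast
      ring)
  refine ⟨r, Nat.Coprime.pow_right 3 hr, ?_⟩
  have hlegendre : ∑ k ∈ range p, ((shiftedLegendre n).coeff k : ℚ) * (2 ^ k + (-1) ^ k) = 0 := by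
    have hev : ∀ x : ℚ, aeval x (shiftedLegendre n) =
        ∑ k ∈ range p, ((shiftedLegendre n).coeff k : ℚ) * x ^ k := by
      intro x
      rw [aeval_eq_sum_range' (n := p) (by rw [natDegree_shiftedLegendre]; omega)]
      exact sum_congr rfl fun k _ => by rw [zsmul_eq_mul]
    -- Reflection sends 2 to 1 − 2 = −1, with sign −1 as n is odd.
    have h := shiftedLegendre_eval_symm n (2 : ℚ)
    rw [hodd.neg_one_pow, hev, hev] at h
    simp only [mul_add, sum_add_distrib]
    rw [h]
    norm_num
  have hterm : ∀ k : ℕ, ((Nat.choose (2 * k) k : ℚ) ^ 2) / (8 : ℚ) ^ k +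
      ((Nat.choose (2 * k) k : ℚ) ^ 2) / (-16 : ℚ) ^ k =
      ((shiftedLegendre n).coeff k : ℚ) * (2 ^ k + (-1) ^ k) + (p : ℚ) ^ 2 *
        (((legendreDefect n k * (2 ^ k + (-1) ^ k) : ℤ) : ℚ) /
          ((4 ^ k * k.factorial ^ 2 : ℕ) : ℚ)) := by
    intro k
    have hd : (4 ^ k * (k.factorial : ℚ) ^ 2) ≠ 0 := by positivity
    have h := centralBinom_sq_sub_shiftedLegendre_coeff n k
    rw [← eq_div_iff hd, sub_eq_iff_eq_add] at h
    have h8 : ((Nat.choose (2 * k) k : ℚ) ^ 2) / (8 : ℚ) ^ k =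
        (Nat.choose (2 * k) k : ℚ) ^ 2 / 16 ^ k * 2 ^ k := by
      rw [show (16 : ℚ) = 8 * 2 by norm_num, mul_pow]
      field_simp
    have h16 : ((Nat.choose (2 * k) k : ℚ) ^ 2) / (-16 : ℚ) ^ k =
        (Nat.choose (2 * k) k : ℚ) ^ 2 / 16 ^ k * (-1) ^ k := by
      rw [show (-16 : ℚ) = 16 * (-1) by norm_num, mul_pow, div_mul_eq_div_div, div_eq_mul_inv _
        ((-1 : ℚ) ^ k), ← inv_pow]
      norm_num
    rw [h8, h16, h, hpn]
    push_cast
    ring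
  rw [sub_neg_eq_add, ← sum_add_distrib, sum_congr rfl fun k _ => hterm k, sum_add_distrib,
    hlegendre, ← mul_sum, hsum]
  push_cast
  ring

end Congruence
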